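/- Let $(\theta_j)_{j\ge1}$ be non-negative real numbers. For a permutation $\pi$ of $\{1,\ldots,n\}$ let $C_j(\pi)$ be the number of its $j$-cycles (fixed points being $1$-cycles), and let $$h_n=\frac1{n!}\sum_{\pi}\prod_{j\ge1}\theta_j^{C_j(\pi)},$$ where the sum is over all permutations of $\{1,\ldots,n\}$. Assume the stability condition $\lim_{n\to\infty}h_{n-1}/h_n=1$ (in particular, $h_n>0$ for all large $n$). For each $n$ let $\sigma_n$ be a random permutation of $\{1,\ldots,n\}$ such that, whenever $h_n\neq0$, $$\mathbb P\{\sigma_n=\pi\}=\frac1{h_n\,n!}\prod_{j\ge1}\theta_j^{C_j(\pi)}\quad\text{for all permutations }\pi\text{ of }\{1,\ldots,n\}.$$ Fix $k\ge2$. Call the range of a cycle the difference between its maximum and minimum elements, and let $r_n^{(k)}$ and $R_n^{(k)}$ be the minimum and the maximum range among all $k$-cycles of $\sigma_n$; if $\sigma_n$ has no $k$-cycles, set $r_n^{(k)}=n$ and $R_n^{(k)}=0$. Then, as $n\to\infty$, $r_n^{(k)}/n$ and $R_n^{(k)}/n$ converge in distribution to random variables $r^{(k)}$ and $R^{(k)}$,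 respectively, whose cumulative distribution functions are given for $x\in[0,1)$ by $$\mathbb P\{r^{(k)}\le x\}=1-\exp\Bigl\{-\frac{\theta_k}k\bigl(kx^{k-1}-(k-1)x^k\bigr)\Bigr\},$$ $$\mathbb P\{R^{(k)}\le x\}=\exp\Bigl\{\frac{\theta_k}k\bigl(kx^{k-1}-(k-1)x^k-1\bigr)\Bigr\},$$ and both are equal to $0$ for $x<0$ and to $1$ for $x\ge1$. -/

import Mathlib

open Filter Topology MeasureTheory ProbabilityTheory

/-- Permutations of `{1, …, n}` are modelled on `Fin n = {0, …, n - 1}`; ranges of cycles are not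
affected by this shift.  `cycleCount k π` is the number of `k`-cycles of `π`; fixed points are the
`1`-cycles (`π.partition` lists all cycle lengths, including those equal to `1`). -/
def cycleCount {n : ℕ} (k : ℕ) (π : Equiv.Perm (Fin n)) : ℕ :=
  π.partition.parts.count k

/-- The weight `∏_{k ≥ 1} θ_k ^ C_k(π)`; the factors with `k > n` are equal to `1`. -/
noncomputable def cycleWeight (θ : ℕ → ℝ) {n : ℕ} (π : Equiv.Perm (Fin n)) : ℝ :=
  ∏ k ∈ Finset.Icc 1 n, θ k ^ cycleCount k π

/-- The normalization `h_n`, so that `∑_π cycleWeight θ π / (h_n n!) = 1` whenever `h_n ≠ 0`. -/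
noncomputable def cycleNorm (θ : ℕ → ℝ) (n : ℕ) : ℝ :=
  (∑ π : Equiv.Perm (Fin n), cycleWeight θ π) / (n.factorial : ℝ)

/-- The `k`-cycles of `π`, for `k ≥ 2`, each seen as a cyclic permutation. -/
def kCycles {n : ℕ} (k : ℕ) (π : Equiv.Perm (Fin n)) : Finset (Equiv.Perm (Fin n)) :=
  π.cycleFactorsFinset.filter fun c => c.support.card = k

/-- The range of a cycle: its maximum element minus its minimum element. -/
def cycleRange {n : ℕ} (c : Equiv.Perm (Fin n)) : ℕ :=
  if h : c.support.Nonempty then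
    (c.support.max' h : ℕ) - (c.support.min' h : ℕ)
  else 0

/-- The minimum range among all `k`-cycles of `π`, and `n` if there are none. -/
def minRange {n : ℕ} (k : ℕ) (π : Equiv.Perm (Fin n)) : ℕ :=
  if h : (kCycles k π).Nonempty then (kCycles k π).inf' h cycleRange else n

/-- The maximum range among all `k`-cycles of `π`, and `0` if there are none. -/
def maxRange {n : ℕ} (k : ℕ) (π : Equiv.Perm (Fin n)) : ℕ :=
  if h : (kCycles k π).Nonempty then (kCycles k π).sup' h cycleRange else 0

/-! The proof is a Poisson limit by factorial moments. Both events concern the number `N` of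
`k`-cycles whose support lies in a family `A n` of `k`-subsets: the minimum range is at most `r`
(for `r < n`) iff some `k`-cycle has a support of range at most `r`, and the maximum range is at
most `r` iff none has a support of range above `r`. So it suffices to find the limit of the
probability that `N = 0`.

The binomial moment of order `m` counts pairs of a permutation and `m` of its cycles counted by `N`.
Deleting these cycles leaves an arbitrary permutation of `n - k m` points and divides the weight by
`θ_k ^ m` (`sum_cycleWeight_filter_subset`). The moment is thus the number of disjoint `m`-families
of such cycles, times `θ_k ^ m h_{n-km} (n-km)! / (h_n n!)`. Stability removes the ratio of the `h`.
If `|A n| ~ a n^k / k!`, there are about `(a / k) n^k` cycles; overlaps cost a factor `n`, so the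
families number about `(a n^k / k)^m / m!`. Hence the moments tend to `(θ_k a / k)^m / m!`
(`tendsto_moment`), and Bonferroni's inequalities give the limit `exp (-θ_k a / k)`.

For sets of range at most `⌊x n⌋`, counting by the maximum gives `a = k x^(k-1) - (k-1) x^k`
(`tendsto_card_narrowSets`); the complementary family gives `1 - a`. Convergence of the distribution
functions at every point then yields convergence in distribution. -/

/-! ### Weights of permutations containing prescribed cycles -/

theorem cycleWeight_eq_prod_map (θ : ℕ → ℝ) {n : ℕ} (π : Equiv.Perm (Fin n)) :
    cycleWeight θ π = (π.cycleType.map θ).prod * θ 1 ^ (n - π.cycleType.sum) := by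
  have h : cycleWeight θ π = (π.partition.parts.map θ).prod := by
    rw [Finset.prod_multiset_map_count, cycleWeight]
    symm
    refine Finset.prod_subset (fun j hj => ?_) (fun j _ hj => ?_)
    · rw [Multiset.mem_toFinset] at hj
      refine Finset.mem_Icc.2 ⟨π.partition.parts_pos hj, ?_⟩
      have := Multiset.le_sum_of_mem hj
      rwa [π.partition.parts_sum, Fintype.card_fin] at this
    · rw [Multiset.mem_toFinset] at hj
      rw [Multiset.count_eq_zero_of_notMem hj, pow_zero]
  rw [h, Equiv.Perm.parts_partition, Multiset.map_add, Multiset.prod_add, Multiset.map_replicate,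
    Multiset.prod_replicate, Fintype.card_fin, Equiv.Perm.sum_cycleType]

theorem cycleWeight_nonneg {θ : ℕ → ℝ} (hθ : ∀ j, 1 ≤ j → 0 ≤ θ j) {n : ℕ}
    (π : Equiv.Perm (Fin n)) : 0 ≤ cycleWeight θ π :=
  Finset.prod_nonneg fun j hj => pow_nonneg (hθ j (Finset.mem_Icc.1 hj).1) _

theorem exists_cycleFactorsFinset_eq {α : Type*} [Fintype α] [DecidableEq α]
    {S : Finset (Equiv.Perm α)} (hS : ∀ c ∈ S, c.IsCycle)
    (hd : (S : Set (Equiv.Perm α)).Pairwise Equiv.Perm.Disjoint) :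
    ∃ g : Equiv.Perm α, g.cycleFactorsFinset = S :=
  ⟨_, Equiv.Perm.cycleFactorsFinset_eq_finset.2 ⟨hS, hd, rfl⟩⟩

/-- The cofactor `ρ` is the product of the cycles of `π` that are not cycles of `g`. -/
theorem cycleFactorsFinset_subset_iff {α : Type*} [Fintype α] [DecidableEq α]
    {g π : Equiv.Perm α} :
    g.cycleFactorsFinset ⊆ π.cycleFactorsFinset ↔
      ∃ ρ : Equiv.Perm α, Equiv.Perm.Disjoint g ρ ∧ g * ρ = π := by
  constructor
  · intro h
    have hdis := π.cycleFactorsFinset_pairwise_disjoint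
    obtain ⟨ρ, hρ⟩ := exists_cycleFactorsFinset_eq
      (S := π.cycleFactorsFinset \ g.cycleFactorsFinset)
      (fun c hc => (Equiv.Perm.mem_cycleFactorsFinset_iff.1 (Finset.mem_sdiff.1 hc).1).1)
      (hdis.mono (by simp))
    have hgρ : Equiv.Perm.Disjoint g ρ := by
      rw [Equiv.Perm.disjoint_iff_disjoint_support, Finset.disjoint_left]
      intro x hx hx'
      have h1 := Equiv.Perm.cycleOf_mem_cycleFactorsFinset_iff.2 hx
      have h2 := Equiv.Perm.cycleOf_mem_cycleFactorsFinset_iff.2 hx'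
      rw [hρ, Finset.mem_sdiff] at h2
      have hne : g.cycleOf x ≠ ρ.cycleOf x := fun he => h2.2 (he ▸ h1)
      have := hdis (h h1) h2.1 hne
      rw [Equiv.Perm.disjoint_iff_disjoint_support, Finset.disjoint_left] at this
      exact this (Equiv.Perm.mem_support_cycleOf_iff.2 ⟨Equiv.Perm.SameCycle.refl _ _, hx⟩)
        (Equiv.Perm.mem_support_cycleOf_iff.2 ⟨Equiv.Perm.SameCycle.refl _ _, hx'⟩)
    refine ⟨ρ, hgρ, Equiv.Perm.cycleFactorsFinset_injective ?_⟩
    rw [hgρ.cycleFactorsFinset_mul_eq_union, hρ, Finset.union_sdiff_of_subset h]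
  · rintro ⟨ρ, h, rfl⟩
    rw [h.cycleFactorsFinset_mul_eq_union]
    exact Finset.subset_union_left

/-- A permutation disjoint from `g` fixes the support of `g` pointwise, so it amounts to a
permutation of the complement. -/
theorem disjoint_iff_exists_extendDomain {α β : Type*} [Fintype β] [DecidableEq β]
    {g : Equiv.Perm β} (f : α ≃ {x // x ∉ g.support}) (ρ : Equiv.Perm β) :
    Equiv.Perm.Disjoint g ρ ↔ ∃ τ : Equiv.Perm α, τ.extendDomain f = ρ := by
  constructor
  · intro h
    have hfix : ∀ x, x ∈ g.support → ρ x = x := fun x hx =>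
      (h x).resolve_left (Equiv.Perm.mem_support.1 hx)
    have hiff : ∀ x, ρ x ∉ g.support ↔ x ∉ g.support := by
      intro x
      refine not_congr ⟨fun hx => ?_, fun hx => by rwa [hfix x hx]⟩
      have := ρ.injective (hfix _ hx)
      rwa [this] at hx
    refine ⟨f.symm.permCongr (ρ.subtypePerm hiff), ?_⟩
    ext x
    by_cases hx : x ∉ g.support
    · rw [Equiv.Perm.extendDomain_apply_subtype _ f hx]
      simp [Equiv.permCongr_apply]
    · rw [Equiv.Perm.extendDomain_apply_not_subtype _ f hx, hfix x (not_not.1 hx)]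
  · rintro ⟨τ, rfl⟩ x
    by_cases hx : x ∉ g.support
    · exact Or.inl (Equiv.Perm.notMem_support.1 hx)
    · exact Or.inr (Equiv.Perm.extendDomain_apply_not_subtype _ f hx)

/-- With `g` the product of `S`, the map `τ ↦ g * τ` is a bijection from the permutations of the
points outside the support of `g` onto those containing the cycles of `S`. -/
theorem sum_cycleWeight_filter_subset (θ : ℕ → ℝ) {n k m : ℕ} {S : Finset (Equiv.Perm (Fin n))}
    (hS : ∀ c ∈ S, c.IsCycle ∧ c.support.card = k) (hm : S.card = m)
    (hd : (S : Set (Equiv.Perm (Fin n))).Pairwise Equiv.Perm.Disjoint) :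
    ∑ π : Equiv.Perm (Fin n) with S ⊆ π.cycleFactorsFinset, cycleWeight θ π =
      θ k ^ m * ∑ ρ : Equiv.Perm (Fin (n - k * m)), cycleWeight θ ρ := by
  obtain ⟨g, hg⟩ := exists_cycleFactorsFinset_eq (fun c hc => (hS c hc).1) hd
  have hgt : g.cycleType = Multiset.replicate m k := by
    rw [Equiv.Perm.cycleType_def, hg, Multiset.eq_replicate]
    refine ⟨by simpa using hm, fun b hb => ?_⟩
    obtain ⟨c, hc, rfl⟩ := Multiset.mem_map.1 hb
    exact (hS c hc).2
  have hgs : g.support.card = k * m := by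
    rw [← Equiv.Perm.sum_cycleType, hgt, Multiset.sum_replicate, smul_eq_mul, mul_comm]
  have hcard : Fintype.card (Fin (n - k * m)) = Fintype.card {x // x ∉ g.support} := by
    rw [Fintype.card_subtype_compl, Fintype.card_fin, Fintype.card_fin, Fintype.card_coe, hgs]
  let f := Fintype.equivOfCardEq hcard
  have hmap : Finset.univ.filter (fun π : Equiv.Perm (Fin n) => S ⊆ π.cycleFactorsFinset) =
      Finset.univ.image fun τ : Equiv.Perm (Fin (n - k * m)) => g * τ.extendDomain f := by
    ext π
    simp only [Finset.mem_filter, Finset.mem_univ, true_and, Finset.mem_image, ← hg,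
      cycleFactorsFinset_subset_iff, disjoint_iff_exists_extendDomain f]
    grind
  rw [hmap, Finset.sum_image, Finset.mul_sum]
  · refine Finset.sum_congr rfl fun τ _ => ?_
    have hdis : Equiv.Perm.Disjoint g (τ.extendDomain f) :=
      (disjoint_iff_exists_extendDomain f _).2 ⟨τ, rfl⟩
    -- Cycle types add, and `g * τ` has as many fixed points as `τ`, so the weight only gains `θ k ^
    -- m`.
    rw [cycleWeight_eq_prod_map, cycleWeight_eq_prod_map, hdis.cycleType_mul,
      Equiv.Perm.cycleType_extendDomain, hgt, Multiset.map_add, Multiset.prod_add,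
      Multiset.map_replicate, Multiset.prod_replicate, Multiset.sum_add, Multiset.sum_replicate,
      smul_eq_mul, mul_assoc, mul_comm m k, Nat.sub_add_eq]
  · intro τ _ τ' _ h
    exact Equiv.Perm.extendDomainHom_injective f (mul_left_cancel h)

/-! ### Counting cycles by their supports -/

open Classical in
theorem card_filter_isCycle_support_eq {α : Type*} [Fintype α] [DecidableEq α] {k : ℕ}
    (hk : 2 ≤ k) {s : Finset α} (hs : s.card = k) :
    (Finset.univ.filter fun c : Equiv.Perm α => c.IsCycle ∧ c.support = s).card =
      (k - 1).factorial := by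
  have h := Equiv.Perm.card_of_cycleType_singleton (α := s) hk (by simp [hs])
  rw [Fintype.card_coe, hs, Nat.choose_self, mul_one] at h
  rw [← h]
  symm
  refine Finset.card_bij (fun g _ => Equiv.Perm.ofSubtype g) ?_ ?_ ?_
  · intro g hg
    simp only [Finset.mem_filter, Finset.mem_univ, true_and] at hg ⊢
    have hg' : (Equiv.Perm.ofSubtype g).cycleType = {k} := by
      rw [Equiv.Perm.cycleType_ofSubtype, hg]
    refine ⟨Equiv.Perm.card_cycleType_eq_one.1 (by rw [hg']; simp), ?_⟩
    refine Finset.eq_of_subset_of_card_le (fun x hx => ?_) ?_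
    · by_contra hxs
      exact Equiv.Perm.mem_support.1 hx (Equiv.Perm.ofSubtype_apply_of_not_mem g hxs)
    · rw [← Equiv.Perm.sum_cycleType, hg', Multiset.sum_singleton, hs]
  · intro g _ g' _ h
    exact Equiv.Perm.ofSubtype_injective h
  · intro c hc
    simp only [Finset.mem_filter, Finset.mem_univ, true_and] at hc
    obtain ⟨hc, rfl⟩ := hc
    have h1 : ∀ x, c x ∈ c.support ↔ x ∈ c.support := fun x => Equiv.Perm.apply_mem_support
    have h2 : Equiv.Perm.ofSubtype (c.subtypePerm h1) = c :=
      Equiv.Perm.ofSubtype_subtypePerm _ fun x hx => Equiv.Perm.mem_support.2 hx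
    refine ⟨c.subtypePerm h1, ?_, h2⟩
    simp only [Finset.mem_filter, Finset.mem_univ, true_and]
    rw [← Equiv.Perm.cycleType_ofSubtype, h2, hc.cycleType, hs]

open Classical in
/-- The cycles whose support belongs to a given family of sets. -/
noncomputable def cyclesOn {α : Type*} [Fintype α] [DecidableEq α] (A : Finset (Finset α)) :
    Finset (Equiv.Perm α) :=
  Finset.univ.filter fun c => c.IsCycle ∧ c.support ∈ A

theorem mem_cyclesOn {α : Type*} [Fintype α] [DecidableEq α] {A : Finset (Finset α)}
    {c : Equiv.Perm α} : c ∈ cyclesOn A ↔ c.IsCycle ∧ c.support ∈ A := by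
  simp [cyclesOn]

theorem card_cyclesOn {α : Type*} [Fintype α] [DecidableEq α] {k : ℕ} (hk : 2 ≤ k)
    {A : Finset (Finset α)} (hA : ∀ s ∈ A, s.card = k) :
    (cyclesOn A).card = A.card * (k - 1).factorial := by
  rw [Finset.card_eq_sum_card_fiberwise (f := Equiv.Perm.support) (t := A)
    (fun c hc => (mem_cyclesOn.1 hc).2), ← smul_eq_mul, ← Finset.sum_const]
  refine Finset.sum_congr rfl fun s hs => ?_
  rw [← card_filter_isCycle_support_eq hk (hA s hs)]
  refine congrArg Finset.card ?_
  ext c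
  simp only [Finset.mem_filter, mem_cyclesOn, Finset.mem_univ, true_and]
  grind

/-- Fixing a point leaves `k - 1` free ones. This is one power of `n` below the order `n ^ k` of all
cycles, which makes overlaps negligible. -/
theorem card_cyclesOn_filter_mem_support_le {n k : ℕ} (hk : 2 ≤ k) {A : Finset (Finset (Fin n))}
    (hA : ∀ s ∈ A, s.card = k) (x : Fin n) :
    ((cyclesOn A).filter fun c => x ∈ c.support).card ≤ n ^ (k - 1) * (k - 1).factorial := by
  have h : (cyclesOn A).filter (fun c => x ∈ c.support) = cyclesOn (A.filter fun s => x ∈ s) := by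
    ext c
    simp only [Finset.mem_filter, mem_cyclesOn]
    tauto
  rw [h, card_cyclesOn hk fun s hs => hA s (Finset.mem_filter.1 hs).1]
  refine Nat.mul_le_mul_right _ ?_
  calc (A.filter fun s => x ∈ s).card
      ≤ (Finset.powersetCard (k - 1) (Finset.univ : Finset (Fin n))).card := by
        refine Finset.card_le_card_of_injOn (fun s => s.erase x) (fun s hs => ?_) ?_
        · have hs := Finset.mem_filter.1 hs
          simp [Finset.mem_powersetCard, Finset.card_erase_of_mem hs.2, hA s hs.1]
        · intro s hs t ht hst
          have hs := (Finset.mem_filter.1 hs).2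
          have ht := (Finset.mem_filter.1 ht).2
          rw [← Finset.insert_erase hs, ← Finset.insert_erase ht]
          exact congrArg _ hst
    _ ≤ n ^ (k - 1) := by
        rw [Finset.card_powersetCard, Finset.card_univ, Fintype.card_fin]
        exact Nat.choose_le_pow _ _

/-! ### Counting sets of bounded range -/

/-- Maximum minus minimum of a set. -/
def setRange {n : ℕ} (s : Finset (Fin n)) : ℕ :=
  if h : s.Nonempty then (s.max' h : ℕ) - (s.min' h : ℕ) else 0

theorem setRange_le_iff {n : ℕ} (s : Finset (Fin n)) (r : ℕ) :
    setRange s ≤ r ↔ ∀ a ∈ s, ∀ b ∈ s, (b : ℕ) ≤ a + r := by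
  unfold setRange
  split_ifs with h
  · constructor
    · intro hr a ha b hb
      have h1 : ((s.min' h : Fin n) : ℕ) ≤ a := s.min'_le a ha
      have h2 : (b : ℕ) ≤ (s.max' h : Fin n) := s.le_max' b hb
      omega
    · intro hr
      have := hr _ (s.min'_mem h) _ (s.max'_mem h)
      omega
  · simp [Finset.not_nonempty_iff_eq_empty.1 h]

theorem setRange_lt {n : ℕ} (hn : 0 < n) (s : Finset (Fin n)) : setRange s < n := by
  unfold setRange
  split_ifs with h
  · have := (s.max' h).2
    omega
  · exact hn

/-- Sort the sets by their maximum `i`: the other `j` elements are chosen among the `min r i`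
naturals in `[i - r, i)`. The induction on `n` splits off the sets with maximum `n`. -/
theorem card_powersetCard_range_filter (j r n : ℕ) :
    ((Finset.powersetCard (j + 1) (Finset.range n)).filter
      fun s => ∀ a ∈ s, ∀ b ∈ s, b ≤ a + r).card = ∑ i ∈ Finset.range n, (min r i).choose j := by
  induction n with
  | zero => simp
  | succ n ih =>
    rw [Finset.sum_range_succ, ← ih, Finset.range_add_one,
      Finset.powersetCard_succ_insert Finset.notMem_range_self, Finset.filter_union,
      Finset.card_union_of_disjoint]
    · congr 1
      have : (Finset.powersetCard j (Finset.Ico (n - r) n)).card = (min r n).choose j := by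
        rw [Finset.card_powersetCard, Nat.card_Ico]
        congr 1
        omega
      rw [← this]
      symm
      refine Finset.card_bij (fun t _ => insert n t) ?_ ?_ ?_
      · intro t ht
        obtain ⟨ht, htc⟩ := Finset.mem_powersetCard.1 ht
        have ht' : ∀ a ∈ t, n - r ≤ a ∧ a < n := fun a ha => Finset.mem_Ico.1 (ht ha)
        refine Finset.mem_filter.2 ⟨Finset.mem_image.2 ⟨t, Finset.mem_powersetCard.2
          ⟨fun a ha => Finset.mem_range.2 (ht' a ha).2, htc⟩, rfl⟩, ?_⟩
        intro a ha b hb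
        rcases Finset.mem_insert.1 ha with ha | ha <;> rcases Finset.mem_insert.1 hb with hb | hb
        · omega
        · have := ht' b hb
          omega
        · have := ht' a ha
          omega
        · have := ht' a ha
          have := ht' b hb
          omega
      · intro t ht t' ht' h
        have h1 : n ∉ t := fun hn => by
          simpa using (Finset.mem_powersetCard.1 ht).1 hn
        have h2 : n ∉ t' := fun hn => by
          simpa using (Finset.mem_powersetCard.1 ht').1 hn
        rw [← Finset.erase_insert h1, ← Finset.erase_insert h2, h]
      · intro s hs
        obtain ⟨hs, hr⟩ := Finset.mem_filter.1 hs
        obtain ⟨t, ht, rfl⟩ := Finset.mem_image.1 hs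
        obtain ⟨ht, htc⟩ := Finset.mem_powersetCard.1 ht
        refine ⟨t, Finset.mem_powersetCard.2 ⟨fun a ha => Finset.mem_Ico.2 ⟨?_, ?_⟩, htc⟩, rfl⟩
        · have := hr a (Finset.mem_insert_of_mem ha) n (Finset.mem_insert_self _ _)
          omega
        · exact Finset.mem_range.1 (ht ha)
    · rw [Finset.disjoint_left]
      intro s hs hs'
      obtain ⟨t, _, rfl⟩ := Finset.mem_image.1 (Finset.mem_filter.1 hs').1
      have := (Finset.mem_powersetCard.1 (Finset.mem_filter.1 hs).1).1
        (Finset.mem_insert_self n t)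
      simp at this

/-- The terms `i < r` sum by the hockey-stick identity; the other `n - r` are constant. -/
theorem sum_range_min_choose (j r n : ℕ) (h : r ≤ n) :
    ∑ i ∈ Finset.range n, (min r i).choose j = (n - r) * r.choose j + r.choose (j + 1) := by
  induction n, h using Nat.le_induction with
  | base =>
    rw [Nat.sub_self, zero_mul, zero_add]
    have h1 : ∀ m, ∑ i ∈ Finset.range m, i.choose j = m.choose (j + 1) := by
      intro m
      induction m with
      | zero => simp
      | succ m ih => rw [Finset.sum_range_succ, ih, Nat.choose_succ_succ, add_comm]
    rw [← h1]
    refine Finset.sum_congr rfl fun i hi => ?_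
    rw [min_eq_right (Finset.mem_range.1 hi).le]
  | succ n hn ih =>
    rw [Finset.sum_range_succ, ih, min_eq_left hn, Nat.succ_sub hn, Nat.succ_mul]
    ring

/-- The `k`-element subsets whose range is at most `r`. -/
def narrowSets (n k r : ℕ) : Finset (Finset (Fin n)) :=
  (Finset.powersetCard k Finset.univ).filter fun s => setRange s ≤ r

/-- The `k`-element subsets whose range exceeds `r`. -/
def wideSets (n k r : ℕ) : Finset (Finset (Fin n)) :=
  (Finset.powersetCard k Finset.univ).filter fun s => ¬ setRange s ≤ r

theorem card_narrowSets (n j r : ℕ) (h : r ≤ n) :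
    (narrowSets n (j + 1) r).card = (n - r) * r.choose j + r.choose (j + 1) := by
  rw [← sum_range_min_choose j r n h, ← card_powersetCard_range_filter]
  refine Finset.card_bij (fun s _ => s.map Fin.valEmbedding) ?_ ?_ ?_
  · intro s hs
    obtain ⟨hs, hr⟩ := Finset.mem_filter.1 hs
    rw [setRange_le_iff] at hr
    refine Finset.mem_filter.2 ⟨Finset.mem_powersetCard.2 ⟨?_, ?_⟩, ?_⟩
    · intro a ha
      obtain ⟨b, _, rfl⟩ := Finset.mem_map.1 ha
      simp
    · rw [Finset.card_map, (Finset.mem_powersetCard.1 hs).2]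
    · simpa using hr
  · intro s _ t _ hst
    exact Finset.map_injective _ hst
  · intro t ht
    obtain ⟨ht, hr⟩ := Finset.mem_filter.1 ht
    obtain ⟨ht, htc⟩ := Finset.mem_powersetCard.1 ht
    have hmap : (Finset.univ.filter fun a : Fin n => (a : ℕ) ∈ t).map Fin.valEmbedding = t := by
      ext a
      simp only [Finset.mem_map, Finset.mem_filter, Finset.mem_univ, true_and,
        Fin.valEmbedding_apply]
      exact ⟨by rintro ⟨b, hb, rfl⟩; exact hb,
        fun ha => ⟨⟨a, Finset.mem_range.1 (ht ha)⟩, ha, rfl⟩⟩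
    refine ⟨Finset.univ.filter fun a : Fin n => (a : ℕ) ∈ t, ?_, hmap⟩
    refine Finset.mem_filter.2 ⟨Finset.mem_powersetCard.2 ⟨Finset.subset_univ _, ?_⟩, ?_⟩
    · rw [← htc, ← Finset.card_map Fin.valEmbedding, hmap]
    · rw [setRange_le_iff]
      intro a ha b hb
      exact hr _ (Finset.mem_filter.1 ha).2 _ (Finset.mem_filter.1 hb).2

theorem card_narrowSets_add_card_wideSets (n k r : ℕ) :
    (narrowSets n k r).card + (wideSets n k r).card = n.choose k := by
  rw [narrowSets, wideSets, Finset.card_filter_add_card_filter_not, Finset.card_powersetCard,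
    Finset.card_univ, Fintype.card_fin]

/-! ### Asymptotics of the set counts -/

theorem tendsto_natCast_sub_div {u : ℕ → ℕ} {x : ℝ}
    (hu : Tendsto (fun n : ℕ => (u n : ℝ) / n) atTop (𝓝 x)) (j : ℕ) :
    Tendsto (fun n : ℕ => ((u n - j : ℕ) : ℝ) / n) atTop (𝓝 x) := by
  have h1 : Tendsto (fun n : ℕ => (u n : ℝ) / n - j / n) atTop (𝓝 x) := by
    simpa using hu.sub (tendsto_const_div_atTop_nhds_zero_nat (j : ℝ))
  refine tendsto_of_tendsto_of_tendsto_of_le_of_le h1 hu (fun n => ?_) (fun n => ?_)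
  · rw [← sub_div]
    have : (u n : ℝ) ≤ ((u n - j : ℕ) : ℝ) + j := by
      exact_mod_cast (by omega : u n ≤ u n - j + j)
    exact div_le_div_of_nonneg_right (by linarith) n.cast_nonneg
  · exact div_le_div_of_nonneg_right (Nat.cast_le.2 (Nat.sub_le _ _)) n.cast_nonneg

theorem tendsto_choose_div_pow {u : ℕ → ℕ} {x : ℝ}
    (hu : Tendsto (fun n : ℕ => (u n : ℝ) / n) atTop (𝓝 x)) (j : ℕ) :
    Tendsto (fun n : ℕ => ((u n).choose j : ℝ) / (n : ℝ) ^ j) atTop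
      (𝓝 (x ^ j / j.factorial)) := by
  have h : Tendsto (fun n : ℕ => ((u n).descFactorial j : ℝ) / (n : ℝ) ^ j) atTop
      (𝓝 (x ^ j)) := by
    induction j with
    | zero => simp
    | succ j ih =>
      have := (tendsto_natCast_sub_div hu j).mul ih
      rw [← pow_succ'] at this
      refine this.congr fun n => ?_
      rw [Nat.descFactorial_succ, Nat.cast_mul, pow_succ', mul_div_mul_comm]
  refine (h.div_const (j.factorial : ℝ)).congr fun n => ?_
  have : (j.factorial : ℝ) ≠ 0 := by positivity
  rw [Nat.descFactorial_eq_factorial_mul_choose, Nat.cast_mul]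
  field_simp

theorem tendsto_card_narrowSets {u : ℕ → ℕ} {x : ℝ} (hun : ∀ n, u n ≤ n)
    (hu : Tendsto (fun n : ℕ => (u n : ℝ) / n) atTop (𝓝 x)) (k : ℕ) (hk : 1 ≤ k) :
    Tendsto (fun n : ℕ => ((narrowSets n k (u n)).card : ℝ) / (n : ℝ) ^ k) atTop
      (𝓝 ((k * x ^ (k - 1) - ((k : ℝ) - 1) * x ^ k) / k.factorial)) := by
  obtain ⟨j, rfl⟩ : ∃ j, k = j + 1 := ⟨k - 1, by omega⟩
  have h1 : Tendsto (fun n : ℕ => 1 - (u n : ℝ) / n) atTop (𝓝 (1 - x)) := hu.const_sub 1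
  have h := (h1.mul (tendsto_choose_div_pow hu j)).add (tendsto_choose_div_pow hu (j + 1))
  have e : (1 - x) * (x ^ j / j.factorial) + x ^ (j + 1) / (j + 1).factorial =
      (((j + 1 : ℕ) : ℝ) * x ^ (j + 1 - 1) - (((j + 1 : ℕ) : ℝ) - 1) * x ^ (j + 1)) /
        (j + 1).factorial := by
    have : (j.factorial : ℝ) ≠ 0 := by positivity
    rw [Nat.factorial_succ]
    push_cast
    field_simp
    simp only [add_tsub_cancel_right]
    ring
  rw [e] at h
  refine h.congr' ?_
  filter_upwards [eventually_gt_atTop 0] with n hn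
  rw [card_narrowSets n j (u n) (hun n)]
  push_cast [Nat.cast_sub (hun n)]
  have : (n : ℝ) ≠ 0 := by positivity
  field_simp
  ring

theorem tendsto_card_wideSets {u : ℕ → ℕ} {x : ℝ} (hun : ∀ n, u n ≤ n)
    (hu : Tendsto (fun n : ℕ => (u n : ℝ) / n) atTop (𝓝 x)) (k : ℕ) (hk : 1 ≤ k) :
    Tendsto (fun n : ℕ => ((wideSets n k (u n)).card : ℝ) / (n : ℝ) ^ k) atTop
      (𝓝 ((1 - (k * x ^ (k - 1) - ((k : ℝ) - 1) * x ^ k)) / k.factorial)) := by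
  have hid : Tendsto (fun n : ℕ => ((id n : ℕ) : ℝ) / n) atTop (𝓝 1) := by
    refine tendsto_const_nhds.congr' ?_
    filter_upwards [eventually_gt_atTop 0] with n hn
    simp [hn.ne']
  have h := (tendsto_choose_div_pow hid k).sub (tendsto_card_narrowSets hun hu k hk)
  rw [one_pow, ← sub_div] at h
  refine h.congr fun n => ?_
  rw [← sub_div, id, ← card_narrowSets_add_card_wideSets n k (u n)]
  push_cast
  ring

/-! ### Disjoint families of cycles -/

open Classical in
/-- The `m`-element subfamilies of `B` consisting of pairwise disjoint permutations. -/
noncomputable def disjointSubfamilies {α : Type*} (B : Finset (Equiv.Perm α)) (m : ℕ) :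
    Finset (Finset (Equiv.Perm α)) :=
  (B.powersetCard m).filter fun S => (S : Set (Equiv.Perm α)).Pairwise Equiv.Perm.Disjoint

theorem mem_disjointSubfamilies {α : Type*} {B : Finset (Equiv.Perm α)} {m : ℕ}
    {S : Finset (Equiv.Perm α)} :
    S ∈ disjointSubfamilies B m ↔
      S ⊆ B ∧ S.card = m ∧ (S : Set (Equiv.Perm α)).Pairwise Equiv.Perm.Disjoint := by
  simp [disjointSubfamilies, Finset.mem_powersetCard, and_assoc]

open Classical in
/-- The members of `B` that are disjoint from every member of `S`. -/
noncomputable def disjointFrom {α : Type*} (B S : Finset (Equiv.Perm α)) :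
    Finset (Equiv.Perm α) :=
  B.filter fun c => ∀ s ∈ S, Equiv.Perm.Disjoint c s

theorem mem_disjointFrom {α : Type*} {B S : Finset (Equiv.Perm α)} {c : Equiv.Perm α} :
    c ∈ disjointFrom B S ↔ c ∈ B ∧ ∀ s ∈ S, Equiv.Perm.Disjoint c s := by
  simp [disjointFrom]

theorem disjointFrom_subset {α : Type*} (B S : Finset (Equiv.Perm α)) : disjointFrom B S ⊆ B :=
  fun _ hc => (mem_disjointFrom.1 hc).1

open Classical in
-- Double counting of pairs `S ⊆ T` with sizes `m` and `m + 1`. The identity is excluded because it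
-- is disjoint from itself, so it could be disjoint from `S` and yet belong to it.
theorem succ_mul_card_disjointSubfamilies {α : Type*} {B : Finset (Equiv.Perm α)}
    (hB : ∀ c ∈ B, c ≠ 1) (m : ℕ) :
    (m + 1) * (disjointSubfamilies B (m + 1)).card =
      ∑ S ∈ disjointSubfamilies B m,
        (disjointFrom B S).card := by
  have h := Finset.sum_card_bipartiteAbove_eq_sum_card_bipartiteBelow
    (s := disjointSubfamilies B m) (t := disjointSubfamilies B (m + 1)) (fun S T => S ⊆ T)
  have h1 : ∀ T ∈ disjointSubfamilies B (m + 1),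
      (Finset.bipartiteBelow (fun S T => S ⊆ T) (disjointSubfamilies B m) T).card = m + 1 := by
    intro T hT
    obtain ⟨hTB, hTc, hTd⟩ := mem_disjointSubfamilies.1 hT
    have : Finset.bipartiteBelow (fun S T => S ⊆ T) (disjointSubfamilies B m) T =
        T.powersetCard m := by
      ext S
      rw [Finset.mem_bipartiteBelow, mem_disjointSubfamilies, Finset.mem_powersetCard]
      constructor
      · rintro ⟨⟨-, hc, -⟩, hST⟩
        exact ⟨hST, hc⟩
      · rintro ⟨hST, hc⟩
        exact ⟨⟨hST.trans hTB, hc, hTd.mono (Finset.coe_subset.2 hST)⟩, hST⟩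
    rw [this, Finset.card_powersetCard, hTc, Nat.choose_succ_self_right]
  have h2 : ∀ S ∈ disjointSubfamilies B m,
      (Finset.bipartiteAbove (fun S T => S ⊆ T) (disjointSubfamilies B (m + 1)) S).card =
        (disjointFrom B S).card := by
    intro S hS
    obtain ⟨hSB, hSc, hSd⟩ := mem_disjointSubfamilies.1 hS
    have hnot : ∀ c ∈ B, (∀ s ∈ S, Equiv.Perm.Disjoint c s) → c ∉ S := fun c hc hd hcS =>
      hB c hc (Equiv.Perm.disjoint_refl_iff.1 (hd c hcS))
    symm
    refine Finset.card_bij (fun c _ => insert c S) ?_ ?_ ?_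
    · intro c hc
      obtain ⟨hcB, hcd⟩ := mem_disjointFrom.1 hc
      have hcS := hnot c hcB hcd
      refine (Finset.mem_bipartiteAbove _).2 ⟨mem_disjointSubfamilies.2
        ⟨Finset.insert_subset hcB hSB, by rw [Finset.card_insert_of_notMem hcS, hSc], ?_⟩,
        Finset.subset_insert _ _⟩
      rw [Finset.coe_insert, Set.pairwise_insert]
      exact ⟨hSd, fun s hs _ => ⟨hcd s hs, (hcd s hs).symm⟩⟩
    · intro c hc c' hc' hcc
      obtain ⟨hcB, hcd⟩ := mem_disjointFrom.1 hc
      have hcS := hnot c hcB hcd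
      have : c ∈ insert c' S := by
        rw [← hcc]
        exact Finset.mem_insert_self _ _
      exact (Finset.mem_insert.1 this).resolve_right hcS
    · intro T hT
      obtain ⟨hT, hST⟩ := (Finset.mem_bipartiteAbove _).1 hT
      obtain ⟨hTB, hTc, hTd⟩ := mem_disjointSubfamilies.1 hT
      obtain ⟨c, hcS, rfl⟩ := Finset.exists_eq_insert_iff.2 ⟨hST, by rw [hSc, hTc]⟩
      refine ⟨c, mem_disjointFrom.2 ⟨hTB (Finset.mem_insert_self _ _), fun s hs => ?_⟩, rfl⟩
      exact hTd (by simp) (by simp [hs]) fun h => hcS (h ▸ hs)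
  rw [Finset.sum_congr rfl h1, Finset.sum_congr rfl h2, Finset.sum_const, smul_eq_mul] at h
  rw [h, mul_comm]

/-- A cycle not disjoint from all of `S` passes through one of the at most `m * k` points moved by
`S`. -/
theorem card_cyclesOn_le_card_filter_disjoint {n k : ℕ} (hk : 2 ≤ k)
    {A : Finset (Finset (Fin n))} (hA : ∀ s ∈ A, s.card = k) {m : ℕ}
    {S : Finset (Equiv.Perm (Fin n))} (hS : S ∈ disjointSubfamilies (cyclesOn A) m) :
    (cyclesOn A).card ≤ (disjointFrom (cyclesOn A) S).card +
      m * k * (n ^ (k - 1) * (k - 1).factorial) := by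
  obtain ⟨hSB, hSc, -⟩ := mem_disjointSubfamilies.1 hS
  rw [← Nat.sub_le_iff_le_add', ← Finset.card_sdiff_of_subset (disjointFrom_subset _ _)]
  have hsub : cyclesOn A \ disjointFrom (cyclesOn A) S ⊆
      (S.biUnion Equiv.Perm.support).biUnion
        fun x => (cyclesOn A).filter fun c => x ∈ c.support := by
    intro c hc
    obtain ⟨hc, hcS⟩ := Finset.mem_sdiff.1 hc
    rw [mem_disjointFrom] at hcS
    push Not at hcS
    obtain ⟨s, hs, hcs⟩ := hcS hc
    rw [Equiv.Perm.disjoint_iff_disjoint_support, Finset.not_disjoint_iff] at hcs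
    obtain ⟨x, hxc, hxs⟩ := hcs
    exact Finset.mem_biUnion.2 ⟨x, Finset.mem_biUnion.2 ⟨s, hs, hxs⟩,
      Finset.mem_filter.2 ⟨hc, hxc⟩⟩
  have hsupp : (S.biUnion Equiv.Perm.support).card ≤ m * k := by
    rw [← hSc]
    exact Finset.card_biUnion_le_card_mul _ _ _ fun s hs => (hA _ (mem_cyclesOn.1 (hSB hs)).2).le
  refine (Finset.card_le_card hsub).trans ((Finset.card_biUnion_le_card_mul _ _ _
    fun x _ => card_cyclesOn_filter_mem_support_le hk hA x).trans ?_)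
  exact Nat.mul_le_mul_right _ hsupp

/-- Induction on `m`: a disjoint family extends by any cycle up to `O(n ^ (k - 1))` exceptions, and
each larger family arises `m + 1` times, which builds up the `m!`. -/
theorem tendsto_card_disjointSubfamilies {k : ℕ} (hk : 2 ≤ k)
    {A : ∀ n : ℕ, Finset (Finset (Fin n))} (hA : ∀ n, ∀ s ∈ A n, s.card = k) {b : ℝ}
    (hb : Tendsto (fun n : ℕ => ((cyclesOn (A n)).card : ℝ) / (n : ℝ) ^ k) atTop (𝓝 b)) (m : ℕ) :
    Tendsto (fun n : ℕ => ((disjointSubfamilies (cyclesOn (A n)) m).card : ℝ) /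
      (n : ℝ) ^ (k * m)) atTop (𝓝 (b ^ m / m.factorial)) := by
  classical
  induction m with
  | zero =>
    have : ∀ n, disjointSubfamilies (cyclesOn (A n)) 0 = {∅} := by
      intro n
      ext S
      rw [mem_disjointSubfamilies, Finset.mem_singleton, Finset.card_eq_zero]
      constructor
      · exact fun h => h.2.1
      · rintro rfl
        simp
    simp [this]
  | succ m ih =>
    set d : ℕ → ℝ := fun n => (disjointSubfamilies (cyclesOn (A n)) m).card with hd
    set C : ℝ := m * k * (k - 1).factorial with hC
    have key : ∀ n : ℕ,
        d n * ((cyclesOn (A n)).card - C * (n : ℝ) ^ (k - 1)) ≤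
          (m + 1) * (disjointSubfamilies (cyclesOn (A n)) (m + 1)).card ∧
        ((m : ℝ) + 1) * (disjointSubfamilies (cyclesOn (A n)) (m + 1)).card ≤
          d n * (cyclesOn (A n)).card := by
      intro n
      have h := congrArg (Nat.cast : ℕ → ℝ) (succ_mul_card_disjointSubfamilies
        (B := cyclesOn (A n)) (fun c hc => (mem_cyclesOn.1 hc).1.ne_one) m)
      push_cast at h
      rw [h]
      constructor
      · rw [hd, ← nsmul_eq_mul]
        refine Finset.card_nsmul_le_sum _ _ _ fun S hS => ?_
        have := card_cyclesOn_le_card_filter_disjoint hk (hA n) hS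
        have : ((cyclesOn (A n)).card : ℝ) ≤
          (disjointFrom (cyclesOn (A n)) S).card +
            m * k * (n ^ (k - 1) * (k - 1).factorial) := by exact_mod_cast this
        rw [hC, mul_assoc _ _ ((n : ℝ) ^ (k - 1)), mul_comm ((k - 1).factorial : ℝ)]
        linarith
      · rw [hd, ← nsmul_eq_mul]
        refine Finset.sum_le_card_nsmul _ _ _ fun S _ => ?_
        exact Nat.cast_le.2 (Finset.card_le_card (disjointFrom_subset _ _))
    have hlim : b ^ (m + 1) / (m + 1).factorial = (b ^ m / m.factorial) * b / (m + 1) := by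
      rw [Nat.factorial_succ]
      push_cast
      field_simp
      ring
    have hsub : Tendsto (fun n : ℕ => ((cyclesOn (A n)).card : ℝ) / (n : ℝ) ^ k - C / n) atTop
        (𝓝 b) := by
      simpa using hb.sub (tendsto_const_div_atTop_nhds_zero_nat C)
    have hm : (0 : ℝ) < m + 1 := by positivity
    rw [hlim]
    refine tendsto_of_tendsto_of_tendsto_of_le_of_le' ((ih.mul hsub).div_const _)
      ((ih.mul hb).div_const _) ?_ ?_
    · filter_upwards [eventually_gt_atTop 0] with n hn
      have hn' : (0 : ℝ) < n := by exact_mod_cast hn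
      have e : (d n / (n : ℝ) ^ (k * m)) * (((cyclesOn (A n)).card : ℝ) / (n : ℝ) ^ k - C / n) =
          d n * ((cyclesOn (A n)).card - C * (n : ℝ) ^ (k - 1)) / (n : ℝ) ^ (k * (m + 1)) := by
        obtain ⟨j, rfl⟩ : ∃ j, k = j + 1 := ⟨k - 1, by omega⟩
        rw [mul_add_one, pow_add _ _ (j + 1), Nat.add_sub_cancel]
        field_simp
        ring
      rw [e, div_le_iff₀ hm, div_mul_eq_mul_div, mul_comm _ ((m : ℝ) + 1)]
      exact div_le_div_of_nonneg_right (key n).1 (by positivity)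
    · refine Eventually.of_forall fun n => ?_
      rw [le_div_iff₀ hm, div_mul_div_comm, ← pow_add, ← mul_add_one, div_mul_eq_mul_div,
        mul_comm _ ((m : ℝ) + 1)]
      exact div_le_div_of_nonneg_right (key n).2 (by positivity)

/-! ### Bonferroni inequalities and the Poisson limit -/

theorem abs_indicator_sub_alternating_sum_choose_le (N M : ℕ) :
    |(if N = 0 then 1 else 0 : ℝ) - ∑ m ∈ Finset.range M, (-1) ^ m * (N.choose m : ℝ)| ≤
      N.choose M := by
  cases M with
  | zero =>
    simp only [Finset.range_zero, Finset.sum_empty, sub_zero, Nat.choose_zero_right, Nat.cast_one]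
    split_ifs <;> simp
  | succ M =>
    cases N with
    | zero => simp [Finset.sum_range_succ']
    | succ N =>
      -- For positive `N` and `M` the truncated alternating sum is, up to sign, `(N - 1).choose (M -
      -- 1)`, a summand of `N.choose M` in Pascal's rule.
      have h := congrArg (Int.cast : ℤ → ℝ)
        (Int.alternating_sum_range_choose_eq_choose (n := N) (m := M))
      push_cast at h
      rw [h, if_neg N.succ_ne_zero, zero_sub, abs_neg, abs_mul, abs_pow, abs_neg, abs_one,
        one_pow, one_mul, Nat.abs_cast, Nat.cast_le, Nat.choose_succ_succ]
      exact Nat.le_add_right _ _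

theorem tendsto_exp_neg_of_bonferroni {p : ℕ → ℝ} {e : ℕ → ℕ → ℝ} {l : ℝ}
    (he : ∀ m, Tendsto (e m) atTop (𝓝 (l ^ m / m.factorial)))
    (hp : ∀ M, ∀ᶠ n in atTop, |p n - ∑ m ∈ Finset.range M, (-1) ^ m * e m n| ≤ e M n) :
    Tendsto p atTop (𝓝 (Real.exp (-l))) := by
  have h1 : Tendsto (fun M => ∑ m ∈ Finset.range M, (-1) ^ m * (l ^ m / m.factorial)) atTop
      (𝓝 (Real.exp (-l))) := by
    have h := (NormedSpace.expSeries_div_hasSum_exp (-l)).tendsto_sum_nat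
    rw [← Real.exp_eq_exp_ℝ] at h
    refine h.congr fun M => Finset.sum_congr rfl fun m _ => ?_
    rw [neg_pow, mul_div_assoc]
  have h2 : Tendsto (fun M : ℕ => l ^ M / M.factorial) atTop (𝓝 0) :=
    FloorSemiring.tendsto_pow_div_factorial_atTop l
  rw [Metric.tendsto_nhds]
  intro ε hε
  -- Fixing `M` before `n` leaves three errors below `ε / 4`: the tail of the exponential series,
  -- the Bonferroni error, and the convergence of finitely many moments.
  obtain ⟨M, hM1, hM2⟩ := ((Metric.tendsto_nhds.1 h1 (ε / 4) (by positivity)).and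
    (h2.eventually_lt_const (show (0 : ℝ) < ε / 4 by positivity))).exists
  have h3 : Tendsto (fun n => ∑ m ∈ Finset.range M, (-1) ^ m * e m n) atTop
      (𝓝 (∑ m ∈ Finset.range M, (-1) ^ m * (l ^ m / m.factorial))) :=
    tendsto_finsetSum _ fun m _ => (he m).const_mul _
  filter_upwards [hp M, Metric.tendsto_nhds.1 h3 (ε / 4) (by positivity),
    (he M).eventually_lt_const hM2] with n hn1 hn2 hn3
  rw [Real.dist_eq] at *
  rw [abs_lt] at *
  rw [abs_le] at hn1
  constructor <;> linarith [hn1.1, hn1.2, hn2.1, hn2.2, hM1.1, hM1.2]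

/-! ### Factorial moments under the weighted measure -/

/-- The binomial coefficient counts the `m`-families of cycles of `π` with supports in `A`;
exchanging the sums fixes the family first. -/
theorem sum_cycleWeight_mul_choose (θ : ℕ → ℝ) {n k : ℕ} {A : Finset (Finset (Fin n))}
    (hA : ∀ s ∈ A, s.card = k) (m : ℕ) :
    ∑ π : Equiv.Perm (Fin n), cycleWeight θ π *
        ((π.cycleFactorsFinset.filter fun c => c.support ∈ A).card.choose m : ℝ) =
      (disjointSubfamilies (cyclesOn A) m).card *
        (θ k ^ m * ∑ ρ : Equiv.Perm (Fin (n - k * m)), cycleWeight θ ρ) := by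
  have hchoose : ∀ π : Equiv.Perm (Fin n),
      (π.cycleFactorsFinset.filter fun c => c.support ∈ A).card.choose m =
        ((disjointSubfamilies (cyclesOn A) m).filter fun S => S ⊆ π.cycleFactorsFinset).card := by
    intro π
    rw [← Finset.card_powersetCard]
    congr 1
    ext S
    rw [Finset.mem_powersetCard, Finset.mem_filter, mem_disjointSubfamilies]
    constructor
    · rintro ⟨hS, hc⟩
      refine ⟨⟨fun c hc => ?_, hc, ?_⟩, hS.trans (Finset.filter_subset _ _)⟩
      · obtain ⟨h1, h2⟩ := Finset.mem_filter.1 (hS hc)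
        exact mem_cyclesOn.2 ⟨(Equiv.Perm.mem_cycleFactorsFinset_iff.1 h1).1, h2⟩
      · exact π.cycleFactorsFinset_pairwise_disjoint.mono
          (Finset.coe_subset.2 (hS.trans (Finset.filter_subset _ _)))
    · rintro ⟨⟨hSB, hc, -⟩, hS⟩
      exact ⟨fun c hc => Finset.mem_filter.2 ⟨hS hc, (mem_cyclesOn.1 (hSB hc)).2⟩, hc⟩
  simp_rw [hchoose, Finset.card_filter, Nat.cast_sum, Finset.mul_sum]
  rw [Finset.sum_comm, ← Finset.mul_sum, ← nsmul_eq_mul, ← Finset.sum_const]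
  refine Finset.sum_congr rfl fun S hS => ?_
  obtain ⟨hSB, hc, hd⟩ := mem_disjointSubfamilies.1 hS
  rw [← Finset.mul_sum, ← sum_cycleWeight_filter_subset θ (k := k) (fun c hc => ⟨(mem_cyclesOn.1 (hSB hc)).1,
    hA _ (mem_cyclesOn.1 (hSB hc)).2⟩) hc hd, Finset.sum_filter]
  refine Finset.sum_congr rfl fun π _ => ?_
  split_ifs <;> simp

theorem cycleNorm_mul_factorial (θ : ℕ → ℝ) (n : ℕ) :
    cycleNorm θ n * n.factorial = ∑ π : Equiv.Perm (Fin n), cycleWeight θ π :=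
  div_mul_cancel₀ _ (by positivity)

theorem eventually_cycleNorm_ne_zero {θ : ℕ → ℝ}
    (hstab : Tendsto (fun n : ℕ => cycleNorm θ n / cycleNorm θ (n + 1)) atTop (𝓝 1)) :
    ∀ᶠ n in atTop, cycleNorm θ n ≠ 0 := by
  filter_upwards [hstab.eventually_ne one_ne_zero] with n hn
  exact (div_ne_zero_iff.1 hn).1

theorem tendsto_cycleNorm_sub_div {θ : ℕ → ℝ}
    (hstab : Tendsto (fun n : ℕ => cycleNorm θ n / cycleNorm θ (n + 1)) atTop (𝓝 1)) (j : ℕ) :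
    Tendsto (fun n : ℕ => cycleNorm θ (n - j) / cycleNorm θ n) atTop (𝓝 1) := by
  have h : Tendsto (fun n : ℕ => cycleNorm θ n / cycleNorm θ (n + j)) atTop (𝓝 1) := by
    induction j with
    | zero =>
      refine tendsto_const_nhds.congr' ?_
      filter_upwards [eventually_cycleNorm_ne_zero hstab] with n hn
      rw [add_zero, div_self hn]
    | succ j ih =>
      have := ih.mul (hstab.comp (tendsto_add_atTop_nat j))
      rw [mul_one] at this
      refine this.congr' ?_
      filter_upwards [(tendsto_add_atTop_nat j).eventually (eventually_cycleNorm_ne_zero hstab)]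
        with n hn
      rw [Function.comp, div_mul_div_cancel₀ hn, add_assoc]
  refine (h.comp (tendsto_sub_atTop_nat j)).congr' ?_
  filter_upwards [eventually_ge_atTop j] with n hn
  rw [Function.comp, Nat.sub_add_cancel hn]

theorem tendsto_moment {θ : ℕ → ℝ}
    (hstab : Tendsto (fun n : ℕ => cycleNorm θ n / cycleNorm θ (n + 1)) atTop (𝓝 1))
    {k : ℕ} (hk : 2 ≤ k) {A : ∀ n : ℕ, Finset (Finset (Fin n))}
    (hA : ∀ n, ∀ s ∈ A n, s.card = k) {b : ℝ}
    (hb : Tendsto (fun n : ℕ => ((cyclesOn (A n)).card : ℝ) / (n : ℝ) ^ k) atTop (𝓝 b)) (m : ℕ) :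
    Tendsto (fun n : ℕ => (∑ π : Equiv.Perm (Fin n), cycleWeight θ π *
        ((π.cycleFactorsFinset.filter fun c => c.support ∈ A n).card.choose m : ℝ)) /
          (cycleNorm θ n * n.factorial)) atTop (𝓝 ((θ k * b) ^ m / m.factorial)) := by
  have h1 := tendsto_card_disjointSubfamilies hk hA hb m
  have h2 := tendsto_cycleNorm_sub_div hstab (k * m)
  have h3 : Tendsto (fun n : ℕ => (n : ℝ) ^ (k * m) / (n.descFactorial (k * m) : ℝ)) atTop
      (𝓝 1) := by
    refine (Asymptotics.isEquivalent_iff_tendsto_one ?_).1 (isEquivalent_descFactorial _).symm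
    filter_upwards [eventually_ge_atTop (k * m)] with n hn
    rw [Nat.cast_ne_zero, ne_eq, Nat.descFactorial_eq_zero_iff_lt]
    omega
  have h := ((h1.mul h2).mul h3).mul_const (θ k ^ m)
  have e : b ^ m / m.factorial * 1 * 1 * θ k ^ m = (θ k * b) ^ m / m.factorial := by
    rw [mul_pow]
    ring
  rw [e] at h
  refine h.congr' ?_
  filter_upwards [eventually_ge_atTop (k * m), eventually_gt_atTop 0] with n hn hn0
  rw [sum_cycleWeight_mul_choose θ (hA n), ← cycleNorm_mul_factorial,
    ← Nat.factorial_mul_descFactorial hn]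
  have hf : ((n - k * m).factorial : ℝ) ≠ 0 := by positivity
  have hn' : (n : ℝ) ≠ 0 := by positivity
  have hd : (n.descFactorial (k * m) : ℝ) ≠ 0 := by
    rw [Nat.cast_ne_zero, ne_eq, Nat.descFactorial_eq_zero_iff_lt]
    omega
  push_cast
  -- If `h_n = 0`, both sides vanish by the convention for division by zero.
  rcases eq_or_ne (cycleNorm θ n) 0 with h0 | h0
  · simp [h0]
  · field_simp

/-- Bonferroni's inequality holds for each `π`, so it survives averaging against the nonnegative
weights. -/
theorem tendsto_weight_no_cycle {θ : ℕ → ℝ} (hθ : ∀ j, 1 ≤ j → 0 ≤ θ j)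
    (hstab : Tendsto (fun n : ℕ => cycleNorm θ n / cycleNorm θ (n + 1)) atTop (𝓝 1))
    {k : ℕ} (hk : 2 ≤ k) {A : ∀ n : ℕ, Finset (Finset (Fin n))}
    (hA : ∀ n, ∀ s ∈ A n, s.card = k) {a : ℝ}
    (ha : Tendsto (fun n : ℕ => ((A n).card : ℝ) / (n : ℝ) ^ k) atTop
      (𝓝 (a / k.factorial))) :
    Tendsto (fun n : ℕ => (∑ π : Equiv.Perm (Fin n) with
        ∀ c ∈ π.cycleFactorsFinset, c.support ∉ A n, cycleWeight θ π) /
          (cycleNorm θ n * n.factorial)) atTop (𝓝 (Real.exp (-(θ k / k * a)))) := by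
  have hb : Tendsto (fun n : ℕ => ((cyclesOn (A n)).card : ℝ) / (n : ℝ) ^ k) atTop
      (𝓝 (a / k)) := by
    have h := ha.mul_const ((k - 1).factorial : ℝ)
    have e : a / k.factorial * (k - 1).factorial = a / k := by
      have hk0 : k ≠ 0 := by omega
      have : ((k - 1).factorial : ℝ) ≠ 0 := by positivity
      rw [← Nat.mul_factorial_pred hk0]
      push_cast
      field_simp
    rw [e] at h
    refine h.congr fun n => ?_
    rw [card_cyclesOn hk (hA n), Nat.cast_mul, div_mul_eq_mul_div]
  rw [div_mul_eq_mul_div, mul_div_assoc]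
  refine tendsto_exp_neg_of_bonferroni (tendsto_moment hstab hk hA hb) fun M => ?_
  refine Eventually.of_forall fun n => ?_
  have hZ : 0 ≤ cycleNorm θ n * n.factorial := by
    rw [cycleNorm_mul_factorial]
    exact Finset.sum_nonneg fun π _ => cycleWeight_nonneg hθ π
  set N : Equiv.Perm (Fin n) → ℕ := fun π =>
    (π.cycleFactorsFinset.filter fun c => c.support ∈ A n).card with hN
  have h0 : ∀ π : Equiv.Perm (Fin n),
      (∀ c ∈ π.cycleFactorsFinset, c.support ∉ A n) ↔ N π = 0 := by
    intro π
    rw [hN, Finset.card_eq_zero, Finset.filter_eq_empty_iff]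
  have e : (∑ π : Equiv.Perm (Fin n) with
      ∀ c ∈ π.cycleFactorsFinset, c.support ∉ A n, cycleWeight θ π) /
        (cycleNorm θ n * n.factorial) - ∑ m ∈ Finset.range M, (-1) ^ m *
        ((∑ π, cycleWeight θ π * ((N π).choose m : ℝ)) / (cycleNorm θ n * n.factorial)) =
      (∑ π, cycleWeight θ π * ((if N π = 0 then 1 else 0 : ℝ) -
        ∑ m ∈ Finset.range M, (-1) ^ m * ((N π).choose m : ℝ))) /
          (cycleNorm θ n * n.factorial) := by
    simp_rw [h0, Finset.sum_filter, mul_sub, Finset.sum_sub_distrib, Finset.mul_sum, mul_ite,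
      mul_one, mul_zero, sub_div]
    congr 1
    rw [Finset.sum_comm, Finset.sum_div]
    refine Finset.sum_congr rfl fun m _ => ?_
    rw [← mul_div_assoc, Finset.mul_sum]
    congr 1
    refine Finset.sum_congr rfl fun π _ => ?_
    ring
  rw [e, abs_div, abs_of_nonneg hZ]
  refine div_le_div_of_nonneg_right ((Finset.abs_sum_le_sum_abs _ _).trans ?_) hZ
  refine Finset.sum_le_sum fun π _ => ?_
  rw [abs_mul, abs_of_nonneg (cycleWeight_nonneg hθ π)]
  exact mul_le_mul_of_nonneg_left (abs_indicator_sub_alternating_sum_choose_le _ _)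
    (cycleWeight_nonneg hθ π)

/-! ### Distribution functions and convergence in distribution -/

/-- Half-open intervals form a π-system containing small neighbourhoods of each point, and their
masses are differences of distribution functions. Convergence is assumed at jumps too, so every
interval may be used. -/
theorem tendstoInDistribution_of_tendsto_cdf {Ω : ℕ → Type*} [∀ n, MeasurableSpace (Ω n)]
    {P : ∀ n, Measure (Ω n)} [∀ n, IsProbabilityMeasure (P n)] {X : ∀ n, Ω n → ℝ}
    (hX : ∀ n, Measurable (X n)) {μ : Measure ℝ} [IsProbabilityMeasure μ]
    (h : ∀ x, Tendsto (fun n => (P n).real {ω | X n ω ≤ x}) atTop (𝓝 (cdf μ x))) :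
    TendstoInDistribution X atTop id P μ := by
  have hIoc : ∀ (ρ : Measure ℝ) [IsProbabilityMeasure ρ] (a b : ℝ), a ≤ b →
      ρ.real (Set.Ioc a b) = ρ.real (Set.Iic b) - ρ.real (Set.Iic a) := by
    intro ρ _ a b hab
    rw [← Set.Iic_sdiff_Iic, measureReal_sdiff (Set.Iic_subset_Iic.2 hab) measurableSet_Iic]
  refine ⟨fun n => (hX n).aemeasurable, aemeasurable_id, ?_⟩
  refine IsPiSystem.tendsto_probabilityMeasure_of_tendsto_of_mem
    (S := {s | ∃ a b : ℝ, s = Set.Ioc a b}) ?_ ?_ ?_ ?_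
  · rintro _ ⟨a, b, rfl⟩ _ ⟨c, d, rfl⟩ -
    exact ⟨_, _, Set.Ioc_inter_Ioc⟩
  · rintro _ ⟨a, b, rfl⟩
    exact measurableSet_Ioc
  · intro u hu x hx
    obtain ⟨ε, hε, hball⟩ := Metric.isOpen_iff.1 hu x hx
    refine ⟨_, ⟨x - ε / 2, x + ε / 2, rfl⟩, Ioc_mem_nhds (by linarith) (by linarith), ?_⟩
    refine fun y hy => hball ?_
    rw [Metric.mem_ball, Real.dist_eq, abs_lt]
    constructor <;> linarith [hy.1, hy.2]
  · rintro _ ⟨a, b, rfl⟩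
    rcases le_total b a with hab | hab
    · simp [Set.Ioc_eq_empty (not_lt.2 hab)]
    · rw [← NNReal.tendsto_coe]
      have hm : ∀ n, IsProbabilityMeasure ((P n).map (X n)) :=
        fun n => Measure.isProbabilityMeasure_map (hX n).aemeasurable
      have h1 : ∀ n y, ((P n).map (X n)).real (Set.Iic y) = (P n).real {ω | X n ω ≤ y} :=
        fun n y => map_measureReal_apply (hX n) measurableSet_Iic
      have h2 : Tendsto (fun n => ((P n).map (X n)).real (Set.Ioc a b)) atTop
          (𝓝 ((μ.map id).real (Set.Ioc a b))) := by
        rw [Measure.map_id, hIoc μ a b hab, ← cdf_eq_real, ← cdf_eq_real]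
        refine ((h b).sub (h a)).congr fun n => ?_
        rw [hIoc _ a b hab, h1, h1]
      exact h2

theorem exists_measure_cdf_eq {φ : ℝ → ℝ} (hc : Continuous φ)
    (hm : MonotoneOn φ (Set.Icc 0 1)) (h0 : 0 ≤ φ 0) (h1 : φ 1 ≤ 1) :
    ∃ (μ : Measure ℝ) (_ : IsProbabilityMeasure μ),
      ∀ x : ℝ, cdf μ x = if x < 0 then 0 else if x < 1 then φ x else 1 := by
  set F : ℝ → ℝ := fun x => if x < 0 then 0 else if x < 1 then φ x else 1 with hF
  have hnonneg : ∀ x, 0 ≤ x → x ≤ 1 → 0 ≤ φ x := fun x hx hx1 =>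
    h0.trans (hm (by simp) ⟨hx, hx1⟩ hx)
  have hle : ∀ x, 0 ≤ x → x ≤ 1 → φ x ≤ 1 := fun x hx hx1 =>
    (hm ⟨hx, hx1⟩ (by simp) hx1).trans h1
  have hmono : Monotone F := by
    intro x y hxy
    simp only [hF]
    split_ifs <;> try linarith
    · exact hnonneg y (by linarith) (by linarith)
    · exact hm ⟨by linarith, by linarith⟩ ⟨by linarith, by linarith⟩ hxy
    · exact hle x (by linarith) (by linarith)
  -- `F` may jump at `0` and at `1`, so only right continuity is available.
  have hright : ∀ x, ContinuousWithinAt F (Set.Ici x) x := by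
    intro x
    rcases lt_or_ge x 0 with hx | hx
    · refine (continuousWithinAt_const (b := (0 : ℝ))).congr_of_eventuallyEq ?_ (by simp [hF, hx])
      filter_upwards [mem_nhdsWithin_of_mem_nhds (Iio_mem_nhds hx)] with y hy
      exact if_pos hy
    · rcases lt_or_ge x 1 with hx1 | hx1
      · refine hc.continuousWithinAt.congr_of_eventuallyEq ?_ (by simp [hF, not_lt.2 hx, hx1])
        filter_upwards [mem_nhdsWithin_of_mem_nhds (Iio_mem_nhds hx1), self_mem_nhdsWithin]
          with y hy hy'
        have hy0 : 0 ≤ y := hx.trans hy'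
        have hy1 : y < 1 := hy
        simp [hF, not_lt.2 hy0, hy1]
      · have hone : ∀ y ∈ Set.Ici x, F y = 1 := by
          intro y hy
          have hy1 : 1 ≤ y := hx1.trans hy
          simp [hF, not_lt.2 hy1, not_lt.2 (zero_le_one.trans hy1)]
        exact (continuousWithinAt_const (b := (1 : ℝ))).congr hone (hone x Set.self_mem_Ici)
  let f : StieltjesFunction ℝ := ⟨F, hmono, hright⟩
  have hbot : Tendsto f atBot (𝓝 0) := by
    refine tendsto_const_nhds.congr' ?_
    filter_upwards [eventually_lt_atBot 0] with x hx
    exact (if_pos hx).symm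
  have htop : Tendsto f atTop (𝓝 1) := by
    refine tendsto_const_nhds.congr' ?_
    filter_upwards [eventually_ge_atTop 1] with x hx
    change 1 = F x
    simp [hF, not_lt.2 hx, not_lt.2 (zero_le_one.trans hx)]
  refine ⟨f.measure, ⟨by rw [f.measure_univ hbot htop, sub_zero, ENNReal.ofReal_one]⟩, fun x => ?_⟩
  rw [cdf_measure_stieltjesFunction f hbot htop]

theorem monotoneOn_mul_pow_sub {k : ℕ} (hk : 2 ≤ k) :
    MonotoneOn (fun x : ℝ => k * x ^ (k - 1) - ((k : ℝ) - 1) * x ^ k) (Set.Icc 0 1) := by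
  obtain ⟨j, rfl⟩ : ∃ j, k = j + 2 := ⟨k - 2, by omega⟩
  refine monotoneOn_of_hasDerivWithinAt_nonneg
    -- The derivative is `k (k - 1) x ^ (k - 2) (1 - x)`.
    (f' := fun x => (j + 2) * ((j + 1) * x ^ j) * (1 - x)) (convex_Icc 0 1) (by fun_prop) ?_ ?_
  · intro x _
    have h := ((hasDerivAt_pow (j + 1) x).const_mul ((j + 2 : ℕ) : ℝ)).sub
      ((hasDerivAt_pow (j + 2) x).const_mul (((j + 2 : ℕ) : ℝ) - 1))
    refine (h.congr_deriv ?_).hasDerivWithinAt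
    push_cast
    ring
  · intro x hx
    rw [interior_Icc] at hx
    have := hx.1.le
    have : 0 ≤ 1 - x := by linarith [hx.2]
    positivity

/-! ### Range events in terms of cycle supports -/

theorem cycleRange_eq_setRange {n : ℕ} (c : Equiv.Perm (Fin n)) :
    cycleRange c = setRange c.support := rfl

/-- The bound `r < n` keeps the default value `n` out of the event when there is no `k`-cycle. -/
theorem minRange_le_iff {n k r : ℕ} (hr : r < n) (π : Equiv.Perm (Fin n)) :
    minRange k π ≤ r ↔ ¬ ∀ c ∈ π.cycleFactorsFinset, c.support ∉ narrowSets n k r := by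
  have h : minRange k π ≤ r ↔ ∃ c ∈ kCycles k π, cycleRange c ≤ r := by
    unfold minRange
    split_ifs with h
    · exact Finset.inf'_le_iff h
    · rw [Finset.not_nonempty_iff_eq_empty.1 h]
      simpa using hr
  rw [h]
  simp [kCycles, narrowSets, cycleRange_eq_setRange, and_assoc]

theorem maxRange_le_iff {n k r : ℕ} (π : Equiv.Perm (Fin n)) :
    maxRange k π ≤ r ↔ ∀ c ∈ π.cycleFactorsFinset, c.support ∉ wideSets n k r := by
  have h : maxRange k π ≤ r ↔ ∀ c ∈ kCycles k π, cycleRange c ≤ r := by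
    unfold maxRange
    split_ifs with h
    · exact Finset.sup'_le_iff ..
    · rw [Finset.not_nonempty_iff_eq_empty.1 h]
      simp
  rw [h]
  simp [kCycles, wideSets, cycleRange_eq_setRange]

theorem cycleRange_le {n : ℕ} (c : Equiv.Perm (Fin n)) : cycleRange c ≤ n := by
  rcases n.eq_zero_or_pos with rfl | hn
  · rw [cycleRange_eq_setRange, setRange_le_iff]
    exact fun a => a.elim0
  · exact (setRange_lt hn _).le

theorem minRange_le {n k : ℕ} (π : Equiv.Perm (Fin n)) : minRange k π ≤ n := by
  unfold minRange
  split_ifs with h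
  · exact (Finset.inf'_le _ h.choose_spec).trans (cycleRange_le _)
  · exact le_rfl

theorem maxRange_le {n k : ℕ} (π : Equiv.Perm (Fin n)) : maxRange k π ≤ n := by
  unfold maxRange
  split_ifs with h
  · exact Finset.sup'_le h _ fun c _ => cycleRange_le c
  · exact Nat.zero_le _

theorem measurable_comp_of_measurableSet_fibers {Ω α : Type*} [MeasurableSpace Ω] [Finite α]
    {σ : Ω → α} (hσ : ∀ a, MeasurableSet {ω | σ ω = a}) (g : α → ℝ) :
    Measurable fun ω => g (σ ω) := by
  intro t _
  have : (fun ω => g (σ ω)) ⁻¹' t = ⋃ a ∈ {a | g a ∈ t}, {ω | σ ω = a} := by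
    ext ω
    simp
  rw [this]
  exact MeasurableSet.biUnion (Set.to_countable _) fun a _ => hσ a

open Classical in
theorem measureReal_eq_sum_cycleWeight {θ : ℕ → ℝ} {n : ℕ} {Ω : Type*} [MeasurableSpace Ω]
    {P : Measure Ω} [IsProbabilityMeasure P] {σ : Ω → Equiv.Perm (Fin n)}
    (hσ : ∀ π, MeasurableSet {ω | σ ω = π})
    (hlaw : ∀ π, P.real {ω | σ ω = π} =
      1 / (cycleNorm θ n * (n.factorial : ℝ)) * cycleWeight θ π)
    (p : Equiv.Perm (Fin n) → Prop) :
    P.real {ω | p (σ ω)} =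
      (∑ π with p π, cycleWeight θ π) / (cycleNorm θ n * n.factorial) := by
  have h : {ω | p (σ ω)} = ⋃ π ∈ Finset.univ.filter p, {ω | σ ω = π} := by
    ext ω
    simp
  rw [h, measureReal_biUnion_finset _ fun π _ => hσ π, Finset.sum_congr rfl fun π _ => hlaw π,
    ← Finset.mul_sum, one_div, div_eq_inv_mul]
  intro π _ π' _ hne
  refine Set.disjoint_left.2 fun ω h1 h2 => hne ?_
  rw [← h1, ← h2]

theorem div_natCast_le_iff {n m : ℕ} (hn : 0 < n) {x : ℝ} (hx : 0 ≤ x) :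
    (m : ℝ) / n ≤ x ↔ m ≤ ⌊x * n⌋₊ := by
  rw [div_le_iff₀ (by exact_mod_cast hn), Nat.le_floor_iff (by positivity)]

/-- Since `M n / n` lies in `[0, 1]`, only `0 ≤ x < 1` requires a limit. -/
theorem tendsto_measureReal_div_le {Ω : ℕ → Type*} [∀ n, MeasurableSpace (Ω n)]
    {P : ∀ n, Measure (Ω n)} [∀ n, IsProbabilityMeasure (P n)] {M : ∀ n, Ω n → ℕ}
    (hM : ∀ n ω, M n ω ≤ n) {φ : ℝ → ℝ}
    (h : ∀ x : ℝ, 0 ≤ x → x < 1 →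
      Tendsto (fun n => (P n).real {ω | M n ω ≤ ⌊x * n⌋₊}) atTop (𝓝 (φ x))) (x : ℝ) :
    Tendsto (fun n => (P n).real {ω | (M n ω : ℝ) / (n : ℝ) ≤ x}) atTop
      (𝓝 (if x < 0 then 0 else if x < 1 then φ x else 1)) := by
  split_ifs with h0 h1
  · refine tendsto_const_nhds.congr fun n => ?_
    have : {ω | (M n ω : ℝ) / (n : ℝ) ≤ x} = ∅ :=
      Set.eq_empty_of_forall_notMem fun ω hω => absurd h0 (not_lt.2 (le_trans (by positivity) hω))
    rw [this, measureReal_empty]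
  · refine (h x (not_lt.1 h0) h1).congr' ?_
    filter_upwards [eventually_gt_atTop 0] with n hn
    simp_rw [div_natCast_le_iff hn (not_lt.1 h0)]
  · refine tendsto_const_nhds.congr fun n => ?_
    have : {ω | (M n ω : ℝ) / (n : ℝ) ≤ x} = Set.univ :=
      Set.eq_univ_of_forall fun ω => (div_le_one_of_le₀ (Nat.cast_le.2 (hM n ω))
        n.cast_nonneg).trans (not_lt.1 h1)
    rw [this, probReal_univ]

theorem tendsto_floor_mul_div {x : ℝ} (hx : 0 ≤ x) :
    Tendsto (fun n : ℕ => ((⌊x * n⌋₊ : ℕ) : ℝ) / n) atTop (𝓝 x) :=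
  (tendsto_nat_floor_mul_div_atTop hx).comp tendsto_natCast_atTop_atTop

theorem floor_mul_natCast_le {x : ℝ} (hx1 : x < 1) (n : ℕ) : ⌊x * n⌋₊ ≤ n :=
  Nat.floor_le_of_le (mul_le_of_le_one_left n.cast_nonneg hx1.le)

theorem floor_mul_natCast_lt {x : ℝ} (hx : 0 ≤ x) (hx1 : x < 1) {n : ℕ} (hn : 0 < n) :
    ⌊x * n⌋₊ < n :=
  (Nat.floor_lt (by positivity)).2 (mul_lt_of_lt_one_left (by exact_mod_cast hn) hx1)

theorem tendsto_measureReal_no_cycle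
    {θ : ℕ → ℝ} (hθ : ∀ j, 1 ≤ j → 0 ≤ θ j)
    (hstab : Tendsto (fun n : ℕ => cycleNorm θ n / cycleNorm θ (n + 1)) atTop (𝓝 1))
    {Ω : ℕ → Type*} [∀ n, MeasurableSpace (Ω n)]
    {P : ∀ n, Measure (Ω n)} [∀ n, IsProbabilityMeasure (P n)]
    {σ : ∀ n, Ω n → Equiv.Perm (Fin n)}
    (hσ_meas : ∀ n, ∀ π : Equiv.Perm (Fin n), MeasurableSet {ω | σ n ω = π})
    (hσ_law : ∀ n, cycleNorm θ n ≠ 0 → ∀ π : Equiv.Perm (Fin n),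
      (P n).real {ω | σ n ω = π} = 1 / (cycleNorm θ n * (n.factorial : ℝ)) * cycleWeight θ π)
    {k : ℕ} (hk : 2 ≤ k) {A : ∀ n : ℕ, Finset (Finset (Fin n))}
    (hA : ∀ n, ∀ s ∈ A n, s.card = k) {a : ℝ}
    (ha : Tendsto (fun n : ℕ => ((A n).card : ℝ) / (n : ℝ) ^ k) atTop
      (𝓝 (a / k.factorial))) :
    Tendsto (fun n => (P n).real {ω | ∀ c ∈ (σ n ω).cycleFactorsFinset, c.support ∉ A n}) atTop
      (𝓝 (Real.exp (-(θ k / k * a)))) := by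
  refine (tendsto_weight_no_cycle hθ hstab hk hA ha).congr' ?_
  filter_upwards [eventually_cycleNorm_ne_zero hstab] with n hn
  rw [measureReal_eq_sum_cycleWeight (hσ_meas n) (hσ_law n hn)
    fun π => ∀ c ∈ π.cycleFactorsFinset, c.support ∉ A n]
  congr!

/-! ### The limit laws -/

theorem proposition4
    (θ : ℕ → ℝ) (hθ : ∀ j, 1 ≤ j → 0 ≤ θ j)
    (hstab : Tendsto (fun n : ℕ => cycleNorm θ n / cycleNorm θ (n + 1)) atTop (𝓝 1))
    {Ω : ℕ → Type*} [∀ n, MeasurableSpace (Ω n)]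
    (P : ∀ n, Measure (Ω n)) [∀ n, IsProbabilityMeasure (P n)]
    (σ : ∀ n, Ω n → Equiv.Perm (Fin n))
    (hσ_meas : ∀ n, ∀ π : Equiv.Perm (Fin n), MeasurableSet {ω | σ n ω = π})
    (hσ_law : ∀ n, cycleNorm θ n ≠ 0 → ∀ π : Equiv.Perm (Fin n),
      (P n).real {ω | σ n ω = π} = 1 / (cycleNorm θ n * (n.factorial : ℝ)) * cycleWeight θ π)
    (k : ℕ) (hk : 2 ≤ k) :
    (∃ (μ : Measure ℝ) (_ : IsProbabilityMeasure μ),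
      (∀ x : ℝ, cdf μ x =
        if x < 0 then 0
        else if x < 1 then
          1 - Real.exp (-(θ k / k) * (k * x ^ (k - 1) - ((k : ℝ) - 1) * x ^ k))
        else 1) ∧
      TendstoInDistribution (fun n ω => (minRange k (σ n ω) : ℝ) / (n : ℝ)) atTop id P μ) ∧
    (∃ (ν : Measure ℝ) (_ : IsProbabilityMeasure ν),
      (∀ x : ℝ, cdf ν x =
        if x < 0 then 0
        else if x < 1 then
          Real.exp (θ k / k * (k * x ^ (k - 1) - ((k : ℝ) - 1) * x ^ k - 1))
        else 1) ∧
      TendstoInDistribution (fun n ω => (maxRange k (σ n ω) : ℝ) / (n : ℝ)) atTop id P ν) := by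
  have hl : 0 ≤ θ k / k := div_nonneg (hθ k (by omega)) k.cast_nonneg
  have hmono := monotoneOn_mul_pow_sub hk
  have hk0 : k ≠ 0 := by omega
  have hk1 : k - 1 ≠ 0 := by omega
  constructor
  · obtain ⟨μ, hμ, hcdf⟩ := exists_measure_cdf_eq
      (φ := fun x => 1 - Real.exp (-(θ k / k) * (k * x ^ (k - 1) - ((k : ℝ) - 1) * x ^ k)))
      (by fun_prop)
      (fun x hx y hy hxy => sub_le_sub_left (Real.exp_le_exp.2
        (mul_le_mul_of_nonpos_left (hmono hx hy hxy) (neg_nonpos.2 hl))) 1)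
      (by simp [hk0, hk1]) (sub_le_self _ (Real.exp_pos _).le)
    refine ⟨μ, hμ, hcdf, tendstoInDistribution_of_tendsto_cdf (fun n =>
      measurable_comp_of_measurableSet_fibers (hσ_meas n) fun π => (minRange k π : ℝ) / n) ?_⟩
    intro x
    rw [hcdf]
    refine tendsto_measureReal_div_le (P := P) (M := fun n ω => minRange k (σ n ω))
      (φ := fun x => 1 - Real.exp (-(θ k / k) * (k * x ^ (k - 1) - ((k : ℝ) - 1) * x ^ k)))
      (fun n ω => minRange_le (σ n ω)) (fun x hx hx1 => ?_) x
    have h := tendsto_measureReal_no_cycle hθ hstab hσ_meas hσ_law hk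
      (A := fun n => narrowSets n k ⌊x * n⌋₊)
      (fun n s hs => (Finset.mem_powersetCard.1 (Finset.mem_filter.1 hs).1).2)
      (tendsto_card_narrowSets (floor_mul_natCast_le hx1) (tendsto_floor_mul_div hx) k (by omega))
    rw [neg_mul]
    refine (h.const_sub 1).congr' ?_
    filter_upwards [eventually_gt_atTop 0] with n hn
    -- The event for the minimum is the complement of having no narrow `k`-cycle.
    rw [← probReal_compl_eq_one_sub]
    · congr 1
      ext ω
      exact (minRange_le_iff (floor_mul_natCast_lt hx hx1 hn) (σ n ω)).symm
    · have : {ω | ∀ c ∈ (σ n ω).cycleFactorsFinset, c.support ∉ narrowSets n k ⌊x * n⌋₊} =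
          {ω | (minRange k (σ n ω) : ℝ) ≤ ⌊x * n⌋₊}ᶜ := by
        ext ω
        simp only [Set.mem_compl_iff, Set.mem_ofPred_eq, Nat.cast_le,
          minRange_le_iff (floor_mul_natCast_lt hx hx1 hn), not_not]
      rw [this]
      exact (measurableSet_le (measurable_comp_of_measurableSet_fibers (hσ_meas n)
        fun π => (minRange k π : ℝ)) measurable_const).compl
  · obtain ⟨ν, hν, hcdf⟩ := exists_measure_cdf_eq
      (φ := fun x => Real.exp (θ k / k * (k * x ^ (k - 1) - ((k : ℝ) - 1) * x ^ k - 1)))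
      (by fun_prop)
      (fun x hx y hy hxy => Real.exp_le_exp.2
        (mul_le_mul_of_nonneg_left (sub_le_sub_right (hmono hx hy hxy) 1) hl))
      (Real.exp_pos _).le (by simp)
    refine ⟨ν, hν, hcdf, tendstoInDistribution_of_tendsto_cdf (fun n =>
      measurable_comp_of_measurableSet_fibers (hσ_meas n) fun π => (maxRange k π : ℝ) / n) ?_⟩
    intro x
    rw [hcdf]
    refine tendsto_measureReal_div_le (P := P) (M := fun n ω => maxRange k (σ n ω))
      (φ := fun x => Real.exp (θ k / k * (k * x ^ (k - 1) - ((k : ℝ) - 1) * x ^ k - 1)))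
      (fun n ω => maxRange_le (σ n ω)) (fun x hx hx1 => ?_) x
    have h := tendsto_measureReal_no_cycle hθ hstab hσ_meas hσ_law hk
      (A := fun n => wideSets n k ⌊x * n⌋₊)
      (fun n s hs => (Finset.mem_powersetCard.1 (Finset.mem_filter.1 hs).1).2)
      (tendsto_card_wideSets (floor_mul_natCast_le hx1) (tendsto_floor_mul_div hx) k (by omega))
    -- For wide sets `a = 1 - (k x^(k-1) - (k-1) x^k)`; the sign is moved inside the exponent.
    rw [← mul_neg, neg_sub] at h
    refine h.congr fun n => ?_
    simp_rw [maxRange_le_iff]
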